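/- Let $1 \le M \le N$ be integers, $c_N = M/N$, $\sigma > 0$, and let $B_N$ be a complex $M \times N$ matrix. Let $\mu_N$ be the deterministic equivalent of the empirical spectral distribution of $\Sigma_N\Sigma_N^*$ in the information plus noise model $\Sigma_N = B_N + \sigma W_N$, that is, the probability measure on $[0,\infty)$ whose Stieltjes transform $m_N(z) = \int \frac{d\mu_N(\lambda)}{\lambda - z}$ satisfies $$m_N(z) = \frac{1}{M}\operatorname{Tr}\left[-z\left(1+\sigma^2 c_N m_N(z)\right) I_M + \sigma^2(1-c_N) I_M + \frac{B_N B_N^*}{1+\sigma^2 c_N m_N(z)}\right]^{-1}, \qquad z \in \mathbb{C}\setminus[0,\infty),$$ and $\operatorname{Im}(z\, m_N(z)) > 0$ for $z \in \mathbb{C}^+ = \{z : \operatorname{Im} z > 0\}$. For real $x$ write $m_N(x) = \lim_{z \in \mathbb{C}^+,\, z \to x} m_N(z)$ when this limit exists. If $c_N < 1$, then $m_N(x)$ exists for every $x \in \mathbb{R}$, and $$\operatorname{Re}\left(1+\sigma^2 c_N m_N(z)\right) \ge \tfrac12 \qquad \text{for all } z \in \mathbb{C}^+ \cup \mathbb{R}.$$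 If $c_N = 1$, then $m_N(x)$ exists for every real $x \ne 0$, and the same inequality holds for all $z \in \mathbb{C}^+ \cup (\mathbb{R}\setminus\{0\})$. -/

import Mathlib

open MeasureTheory Filter Topology

/-- The open upper half-plane `ℂ⁺`. -/
def upperHalf : Set ℂ := {z : ℂ | 0 < z.im}

/-- The nonnegative real axis `ℝ⁺ = [0, ∞)`, as a subset of `ℂ`. -/
def nonnegAxis : Set ℂ := (fun x : ℝ => (x : ℂ)) '' Set.Ici 0

/-- The Stieltjes transform `z ↦ ∫ dμ(t) / (t - z)` of a finite measure on `ℝ`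
(meaningful for `z` outside the support of `μ`). -/
noncomputable def stieltjes (μ : Measure ℝ) (z : ℂ) : ℂ :=
  ∫ t : ℝ, ((t : ℂ) - z)⁻¹ ∂μ

/-- The ratio `c = M / N` of the dimensions. -/
noncomputable def dimRatio (M N : ℕ) : ℝ := (M : ℝ) / (N : ℝ)

/-- The right-hand side of the canonical equation, as a function of `z` and of a candidate value
`m`: `(1/M) Tr [ -z (1 + σ² c m) I + σ² (1 - c) I + B B* / (1 + σ² c m) ]⁻¹`. -/
noncomputable def canonicalRHS {M N : ℕ} (B : Matrix (Fin M) (Fin N) ℂ) (σ : ℝ) (z m : ℂ) : ℂ :=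
  let c : ℂ := (dimRatio M N : ℂ)
  let u : ℂ := 1 + (σ : ℂ) ^ 2 * c * m
  (1 / (M : ℂ)) *
    Matrix.trace
      (((-(z * u)) • (1 : Matrix (Fin M) (Fin M) ℂ)
        + ((σ : ℂ) ^ 2 * (1 - c)) • (1 : Matrix (Fin M) (Fin M) ℂ)
        + u⁻¹ • (B * B.conjTranspose))⁻¹)

/-- `μ` is the deterministic equivalent of the spectral distribution of `Σ Σ*`, where
`Σ = B + σ W` is the `M × N` information plus noise model: the probability measure on `[0, ∞)`
whose Stieltjes transform `m` solves the canonical equation on `ℂ \ ℝ⁺` and satisfies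
`Im (z m(z)) > 0` on `ℂ⁺`. These conditions determine `μ`. -/
structure IsDeterministicEquivalent {M N : ℕ} (B : Matrix (Fin M) (Fin N) ℂ) (σ : ℝ)
    (μ : Measure ℝ) : Prop where
  isProbabilityMeasure : IsProbabilityMeasure μ
  nonneg_support : μ (Set.Iio 0) = 0
  equation : ∀ z : ℂ, z ∉ nonnegAxis → stieltjes μ z = canonicalRHS B σ z (stieltjes μ z)
  im_pos : ∀ z ∈ upperHalf, 0 < (z * stieltjes μ z).im

/-- `ℓ` is the boundary value of the Stieltjes transform of `μ` at the real point `x`, that is, the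
limit of `stieltjes μ z` as `z ∈ ℂ⁺` tends to `x`. -/
def IsBoundaryValue (μ : Measure ℝ) (x : ℝ) (ℓ : ℂ) : Prop :=
  Tendsto (stieltjes μ) (𝓝[upperHalf] (x : ℂ)) (𝓝 ℓ)

/-! Put `k = σ²c`, `s = σ²(1-c)`, `u = 1 + k m`. Diagonalising `B B*`, with eigenvalues `l i`, gives
`m` as the mean of `1 / D i`, where `D i = -z u + s + l i / u`. Writing `1 / D i = conj (D i) / |D
i|²` turns this into the balance `u (1 - β) = 1 + s α - α conj (z u)` with `α > 0`, `β ≥ 0`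
(`exists_balance`). Imaginary parts give `α |z| ≤ 1 - β`, and then taking norms forces `Re u ≥ 1/2`.

For boundary values, Cauchy–Schwarz gives `k |m|² ≤ α`, so `m` is bounded near `x ≠ 0`, and near `0`
too when `s > 0` (`eventually_norm_le`). Every cluster value of `m` at `x` makes `u` a root of a
nonzero polynomial, so there are finitely many; connectedness of half-balls leaves only one
(`exists_tendsto_of_finite_mapClusterPt`). The inequality passes to the limit. -/

/-! ### The balance equation and the bound on `Re u`. -/

/-- Comparing the imaginary parts of the balance equation `h` and of `z` times it bounds `α`
and `β`. -/
theorem one_sub_pos_and_mul_norm_le {α β s : ℝ} {z u : ℂ} (hα : 0 < α) (hs : 0 ≤ s)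
    (hz : 0 < z.im) (hu : 0 ≤ u.im) (hzu : 0 < (z * u).im)
    (h : u * (1 - β) = 1 + s * α - α * (starRingEnd ℂ) (z * u)) :
    0 < 1 - β ∧ α * ‖z‖ ≤ 1 - β := by
  have h1 : (1 - β) * u.im = α * (z * u).im := by
    have := congrArg Complex.im h
    simp at this ⊢
    linarith
  have h2 : (1 - β) * (z * u).im = z.im * (1 + s * α) + α * ‖z‖ ^ 2 * u.im := by
    have := congrArg (fun w => (z * w).im) h
    rw [← Complex.normSq_eq_norm_sq, Complex.normSq_apply]
    simp at this ⊢
    linarith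
  have hab : 0 < α * (z * u).im := mul_pos hα hzu
  have hu' : 0 < u.im := hu.lt_of_ne (fun h0 => by rw [← h0] at h1; linarith)
  have hβ : 0 < 1 - β := by
    rw [← h1] at hab
    exact (pos_iff_pos_of_mul_pos hab).2 hu'
  refine ⟨hβ, ?_⟩
  have h3 : α * ‖z‖ ^ 2 * u.im ≤ (1 - β) * (z * u).im := by
    have : 0 ≤ z.im * (1 + s * α) := by positivity
    linarith
  have h4 : (α * ‖z‖) ^ 2 * (u.im * (z * u).im) ≤ (1 - β) ^ 2 * (u.im * (z * u).im) := by
    calc (α * ‖z‖) ^ 2 * (u.im * (z * u).im)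
        = (α * ‖z‖ ^ 2 * u.im) * (α * (z * u).im) := by ring
      _ ≤ ((1 - β) * (z * u).im) * (α * (z * u).im) :=
          mul_le_mul_of_nonneg_right h3 hab.le
      _ = _ := by rw [← h1]; ring
  exact le_of_sq_le_sq (le_of_mul_le_mul_right h4 (by positivity)) hβ.le

/-- By the balance, `u (1 - β)` lies within `(1 - β) |u|` of `1 + s α`. Squaring cancels `|u|²` and
leaves `1 + s α ≤ 2 (1 - β) Re u`, where `1 - β ≤ 1`. -/
theorem half_le_re {α β s : ℝ} {z u : ℂ} (hα : 0 < α) (hβ : 0 ≤ β) (hs : 0 ≤ s)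
    (hβ1 : 0 < 1 - β) (hαz : α * ‖z‖ ≤ 1 - β)
    (h : u * (1 - β) = 1 + s * α - α * (starRingEnd ℂ) (z * u)) :
    1 / 2 ≤ u.re := by
  have h1 : ‖u * (1 - β) - (1 + s * α)‖ ≤ (1 - β) * ‖u‖ := by
    have : u * (1 - β) - (1 + s * α) = -(α * (starRingEnd ℂ) (z * u)) := by rw [h]; ring
    rw [this, norm_neg, norm_mul, RCLike.norm_conj, norm_mul, Complex.norm_real,
      Real.norm_of_nonneg hα.le, ← mul_assoc]
    exact mul_le_mul_of_nonneg_right hαz (norm_nonneg _)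
  have h2 := pow_le_pow_left₀ (norm_nonneg _) h1 2
  rw [mul_pow, ← Complex.normSq_eq_norm_sq, ← Complex.normSq_eq_norm_sq, Complex.normSq_apply,
    Complex.normSq_apply] at h2
  simp at h2
  have h3 : (1 + s * α) * (1 + s * α) ≤ (1 + s * α) * (2 * (1 - β) * u.re) := by nlinarith
  have h4 : 1 + s * α ≤ 2 * (1 - β) * u.re := le_of_mul_le_mul_left h3 (by positivity)
  have h5 : 0 ≤ s * α := by positivity
  by_contra! hlt
  nlinarith

theorem norm_sq_sum_inv {ι : Type*} [Fintype ι] [Nonempty ι] (D : ι → ℂ) :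
    ‖(1 / (Fintype.card ι : ℂ)) * ∑ i, (D i)⁻¹‖ ^ 2 ≤
      (1 / (Fintype.card ι : ℝ)) * ∑ i, (Complex.normSq (D i))⁻¹ := by
  have hM : (0 : ℝ) < Fintype.card ι := by exact_mod_cast Fintype.card_pos
  have h1 : ‖∑ i, (D i)⁻¹‖ ^ 2 ≤ (Fintype.card ι : ℝ) * ∑ i, (Complex.normSq (D i))⁻¹ := by
    calc ‖∑ i, (D i)⁻¹‖ ^ 2 ≤ (∑ i, ‖(D i)⁻¹‖) ^ 2 :=
          pow_le_pow_left₀ (norm_nonneg _) (norm_sum_le _ _) 2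
      _ ≤ (Fintype.card ι : ℝ) * ∑ i, ‖(D i)⁻¹‖ ^ 2 := sq_sum_le_card_mul_sum_sq
      _ = _ := by simp [Complex.normSq_eq_norm_sq]
  rw [norm_mul, mul_pow]
  simp only [norm_div, norm_one, Complex.norm_natCast]
  calc (1 / (Fintype.card ι : ℝ)) ^ 2 * ‖∑ i, (D i)⁻¹‖ ^ 2
      ≤ (1 / (Fintype.card ι : ℝ)) ^ 2 *
        ((Fintype.card ι : ℝ) * ∑ i, (Complex.normSq (D i))⁻¹) := by gcongr
    _ = _ := by field_simp

/-- The resolvent denominators of the canonical equation. -/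
noncomputable def resolventDenom (s l : ℝ) (z u : ℂ) : ℂ := -(z * u) + s + u⁻¹ * l

/-- The term `-z u` has negative imaginary part, `s` is real, and `l / u` has nonpositive imaginary
part. -/
theorem resolventDenom_ne_zero {s l : ℝ} {z u : ℂ} (hl : 0 ≤ l)
    (hu : 0 ≤ u.im) (hzu : 0 < (z * u).im) : resolventDenom s l z u ≠ 0 := by
  intro h
  have h1 := congrArg Complex.im h
  have h2 : 0 ≤ u.im / Complex.normSq u * l := by
    have := Complex.normSq_nonneg u
    positivity
  simp only [resolventDenom, Complex.add_im, Complex.neg_im, Complex.ofReal_im,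
    Complex.im_mul_ofReal, Complex.inv_im, Complex.zero_im] at h1
  rw [neg_div, neg_mul] at h1
  linarith

theorem exists_balance {ι : Type*} [Fintype ι] [Nonempty ι] {l : ι → ℝ} (hl : ∀ i, 0 ≤ l i)
    {k s : ℝ} (hk : 0 < k) {z m u : ℂ} (hm : u = 1 + k * m)
    (hu : 0 ≤ u.im) (hzu : 0 < (z * u).im)
    (heq : m = (1 / (Fintype.card ι : ℂ)) * ∑ i, (resolventDenom s (l i) z u)⁻¹) :
    ∃ α β : ℝ, 0 < α ∧ 0 ≤ β ∧ k * ‖m‖ ^ 2 ≤ α ∧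
      u * (1 - β) = 1 + s * α - α * (starRingEnd ℂ) (z * u) := by
  have hM : (0 : ℝ) < Fintype.card ι := by exact_mod_cast Fintype.card_pos
  have hu0 : u ≠ 0 := by rintro rfl; simp at hzu
  have hD := fun i => resolventDenom_ne_zero (s := s) (hl i) hu hzu
  set D := fun i => resolventDenom s (l i) z u with hDdef
  have hN : ∀ i, 0 < Complex.normSq (D i) := fun i => Complex.normSq_pos.2 (hD i)
  refine ⟨k * ((1 / (Fintype.card ι : ℝ)) * ∑ i, (Complex.normSq (D i))⁻¹),
    k * ((1 / (Fintype.card ι : ℝ)) * ∑ i, l i * (Complex.normSq (D i))⁻¹ / Complex.normSq u),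
    ?_, ?_, ?_, ?_⟩
  · have : 0 < ∑ i, (Complex.normSq (D i))⁻¹ :=
      Finset.sum_pos (fun i _ => inv_pos.2 (hN i)) Finset.univ_nonempty
    positivity
  · have : 0 ≤ ∑ i, l i * (Complex.normSq (D i))⁻¹ / Complex.normSq u :=
      Finset.sum_nonneg fun i _ => div_nonneg
        (mul_nonneg (hl i) (inv_nonneg.2 (hN i).le)) (Complex.normSq_nonneg u)
    positivity
  · have := norm_sq_sum_inv D
    rw [heq]
    exact mul_le_mul_of_nonneg_left this hk.le
  -- Here `1 / conj u = u / |u|²`, so the eigenvalue term of `conj (D i)` is a real multiple of `u`;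
  -- these terms add up to `β u`.
  · have key : ∀ i, (D i)⁻¹ = -(starRingEnd ℂ) (z * u) * ((Complex.normSq (D i))⁻¹ : ℝ)
        + s * ((Complex.normSq (D i))⁻¹ : ℝ)
        + u * ((l i * (Complex.normSq (D i))⁻¹ / Complex.normSq u : ℝ) : ℂ) := by
      intro i
      have hc : (starRingEnd ℂ) (D i) = -(starRingEnd ℂ) (z * u) + s
          + u * (l i / Complex.normSq u : ℝ) := by
        have : ((starRingEnd ℂ) u)⁻¹ = u * ((Complex.normSq u)⁻¹ : ℝ) := by
          rw [Complex.inv_def, Complex.conj_conj, Complex.normSq_conj]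
        simp only [hDdef, resolventDenom, map_add, map_neg, map_mul, map_inv₀,
          Complex.conj_ofReal, this]
        push_cast
        ring
      rw [Complex.inv_def, hc]
      push_cast
      ring
    have hsum : m = (1 / (Fintype.card ι : ℂ)) * ∑ i, (D i)⁻¹ := heq
    simp_rw [key] at hsum
    rw [Finset.sum_add_distrib, Finset.sum_add_distrib, ← Finset.mul_sum, ← Finset.mul_sum,
      ← Finset.mul_sum] at hsum
    have h2 : u - 1 = k * m := by rw [hm]; ring
    rw [hsum] at h2
    push_cast at h2 ⊢
    linear_combination h2

/-! ### Diagonalising the trace. -/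

theorem trace_inv_smul_add_smul {M : ℕ} {A : Matrix (Fin M) (Fin M) ℂ} (hA : A.IsHermitian)
    {p q : ℂ} (h : ∀ i, p + q * (hA.eigenvalues i : ℂ) ≠ 0) :
    Matrix.trace ((p • (1 : Matrix (Fin M) (Fin M) ℂ) + q • A)⁻¹) =
      ∑ i, (p + q * (hA.eigenvalues i : ℂ))⁻¹ := by
  set U : Matrix (Fin M) (Fin M) ℂ := (hA.eigenvectorUnitary : Matrix (Fin M) (Fin M) ℂ) with hU
  have h1 : U * star U = 1 := Unitary.coe_mul_star_self _
  have h2 : star U * U = 1 := Unitary.coe_star_mul_self _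
  have hs : A = U * Matrix.diagonal (fun i => (hA.eigenvalues i : ℂ)) * star U := by
    have := hA.spectral_theorem
    rw [Unitary.conjStarAlgAut_apply] at this
    exact this
  have hd : p • (1 : Matrix (Fin M) (Fin M) ℂ) + q • A =
      U * Matrix.diagonal (fun i => p + q * (hA.eigenvalues i : ℂ)) * star U := by
    have : Matrix.diagonal (fun i => p + q * (hA.eigenvalues i : ℂ)) =
        p • (1 : Matrix (Fin M) (Fin M) ℂ) +
          q • Matrix.diagonal (fun i => (hA.eigenvalues i : ℂ)) := by
      ext i j
      by_cases hij : i = j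
      · subst hij; simp
      · simp [hij]
    rw [this, mul_add, add_mul, Matrix.mul_smul, Matrix.mul_one, Matrix.smul_mul, h1,
      Matrix.mul_smul, Matrix.smul_mul, ← hs]
  have hinv : (p • (1 : Matrix (Fin M) (Fin M) ℂ) + q • A)⁻¹ =
      U * Matrix.diagonal (fun i => (p + q * (hA.eigenvalues i : ℂ))⁻¹) * star U := by
    apply Matrix.inv_eq_right_inv
    rw [hd]
    calc _ = U * Matrix.diagonal (fun i => p + q * (hA.eigenvalues i : ℂ)) * (star U * U) *
          Matrix.diagonal (fun i => (p + q * (hA.eigenvalues i : ℂ))⁻¹) * star U := by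
            simp only [Matrix.mul_assoc]
      _ = U * (Matrix.diagonal (fun i => p + q * (hA.eigenvalues i : ℂ)) *
          Matrix.diagonal (fun i => (p + q * (hA.eigenvalues i : ℂ))⁻¹)) * star U := by
            rw [h2]; simp only [Matrix.mul_assoc, Matrix.mul_one]
      _ = 1 := by
            rw [Matrix.diagonal_mul_diagonal]
            simp [mul_inv_cancel₀ (h _), h1]
  rw [hinv, Matrix.trace_mul_comm, ← Matrix.mul_assoc, h2, Matrix.one_mul, Matrix.trace_diagonal]

/-! ### Convergence at a boundary point. -/

theorem convex_upperHalf : Convex ℝ upperHalf := convex_halfSpace_im_gt 0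

theorem nhdsWithin_upperHalf_neBot (x : ℝ) : (𝓝[upperHalf] (x : ℂ)).NeBot := by
  rw [← mem_closure_iff_nhdsWithin_neBot]
  have : upperHalf = {z : ℂ | 0 < z.im} := rfl
  rw [this, Complex.closure_setOfPred_lt_im]
  simp

/-- Near a point of the closure of a convex set, a bounded continuous function whose cluster
values lie in a finite set converges. -/
theorem exists_tendsto_of_finite_mapClusterPt {U : Set ℂ} (hU : Convex ℝ U) {x : ℂ}
    [(𝓝[U] x).NeBot] {g : ℂ → ℂ} (hg : ContinuousOn g U) {C : ℝ}
    (hC : ∀ᶠ z in 𝓝[U] x, ‖g z‖ ≤ C) {F : Set ℂ} (hF : F.Finite)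
    (hcl : ∀ ℓ, MapClusterPt ℓ (𝓝[U] x) g → ℓ ∈ F) :
    ∃ ℓ, Tendsto g (𝓝[U] x) (𝓝 ℓ) := by
  have hK : IsCompact (Metric.closedBall (0 : ℂ) C) := isCompact_closedBall _ _
  have hmem : ∀ᶠ z in 𝓝[U] x, g z ∈ Metric.closedBall (0 : ℂ) C := by
    simpa using hC
  obtain ⟨a, -, ha⟩ := hK.exists_mapClusterPt_of_frequently hmem.frequently
  refine ⟨a, hK.tendsto_nhds_of_unique_mapClusterPt hmem fun b _ hb => ?_⟩
  by_contra hab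
  have hd : 0 < dist b a := dist_pos.2 hab
  -- A radius separating `a` from `b` whose sphere around `a` misses `F`. By connectedness `g` meets
  -- this sphere arbitrarily close to `x`, and compactness then produces a cluster value on it.
  obtain ⟨r, hr, hrF⟩ : ∃ r ∈ Set.Ioo 0 (dist b a), r ∉ (fun p => dist p a) '' F :=
    ((Set.Ioo_infinite hd).sdiff (hF.image _)).nonempty
  have hfa : ∃ᶠ z in 𝓝[U] x, dist (g z) a < r :=
    ha.frequently (Metric.ball_mem_nhds a hr.1)
  have hfb : ∃ᶠ z in 𝓝[U] x, r < dist (g z) a :=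
    hb.frequently ((isOpen_lt continuous_const (continuous_id.dist continuous_const)).mem_nhds hr.2)
  have hfr : ∃ᶠ z in 𝓝[U] x, g z ∈ Metric.sphere a r := by
    rw [(nhdsWithin_hasBasis Metric.nhds_basis_ball U).frequently_iff] at hfa hfb ⊢
    intro ε hε
    obtain ⟨p, hp, hpa⟩ := hfa ε hε
    obtain ⟨q, hq, hqb⟩ := hfb ε hε
    have hconv : IsPreconnected (Metric.ball x ε ∩ U) :=
      ((convex_ball x ε).inter hU).isPreconnected
    have hcont : ContinuousOn (fun z => dist (g z) a) (Metric.ball x ε ∩ U) :=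
      (continuous_id.dist continuous_const).comp_continuousOn (hg.mono Set.inter_subset_right)
    obtain ⟨z, hz, hzr⟩ := hconv.intermediate_value hp hq hcont ⟨hpa.le, hqb.le⟩
    exact ⟨z, hz, hzr⟩
  obtain ⟨c, hc, hcc⟩ := (isCompact_sphere a r).exists_mapClusterPt_of_frequently hfr
  exact hrF ⟨c, hcl c hcc, hc⟩

/-! ### Stieltjes transforms on the upper half-plane. -/

theorem im_le_norm_ofReal_sub (t : ℝ) (z : ℂ) : z.im ≤ ‖(t : ℂ) - z‖ := by
  have := Complex.abs_im_le_norm ((t : ℂ) - z)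
  simp at this
  exact (le_abs_self _).trans this

theorem ofReal_sub_ne_zero (t : ℝ) {z : ℂ} (hz : z ∈ upperHalf) : (t : ℂ) - z ≠ 0 :=
  norm_pos_iff.1 (lt_of_lt_of_le hz (im_le_norm_ofReal_sub t z))

theorem continuous_inv_ofReal_sub {z : ℂ} (hz : z ∈ upperHalf) :
    Continuous fun t : ℝ => ((t : ℂ) - z)⁻¹ :=
  (Complex.continuous_ofReal.sub continuous_const).inv₀ fun t => ofReal_sub_ne_zero t hz

theorem norm_inv_ofReal_sub_le (t : ℝ) {z : ℂ} {d : ℝ} (hd : 0 < d) (hz : d ≤ z.im) :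
    ‖((t : ℂ) - z)⁻¹‖ ≤ d⁻¹ := by
  rw [norm_inv]
  exact inv_anti₀ hd (hz.trans (im_le_norm_ofReal_sub t z))

theorem continuousOn_stieltjes (μ : Measure ℝ) [IsFiniteMeasure μ] :
    ContinuousOn (stieltjes μ) upperHalf := by
  intro z hz
  apply ContinuousAt.continuousWithinAt
  have hz' : 0 < z.im := hz
  have hev : ∀ᶠ w : ℂ in 𝓝 z, z.im / 2 < w.im :=
    Complex.continuous_im.continuousAt.eventually_const_lt (by linarith)
  refine continuousAt_of_dominated (bound := fun _ => (z.im / 2)⁻¹) ?_ ?_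
    (integrable_const _) ?_
  · filter_upwards [hev] with w hw
    exact (continuous_inv_ofReal_sub (z := w)
      (show 0 < w.im by linarith)).aestronglyMeasurable
  · filter_upwards [hev] with w hw
    exact Eventually.of_forall fun t => norm_inv_ofReal_sub_le t (by linarith) hw.le
  · exact Eventually.of_forall fun t =>
      (continuousAt_const.sub continuousAt_id).inv₀ (ofReal_sub_ne_zero t hz)

theorem stieltjes_im_nonneg (μ : Measure ℝ) [IsFiniteMeasure μ] {z : ℂ} (hz : z ∈ upperHalf) :
    0 ≤ (stieltjes μ z).im := by
  have hz' : 0 < z.im := hz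
  have hint : Integrable (fun t : ℝ => ((t : ℂ) - z)⁻¹) μ :=
    (integrable_const (z.im)⁻¹).mono' (continuous_inv_ofReal_sub hz).aestronglyMeasurable
      (Eventually.of_forall fun t => norm_inv_ofReal_sub_le t hz' le_rfl)
  have : (stieltjes μ z).im = ∫ t : ℝ, (((t : ℂ) - z)⁻¹).im ∂μ := (integral_im hint).symm
  rw [this]
  refine integral_nonneg fun t => ?_
  simp only [Pi.zero_apply, Complex.inv_im, Complex.sub_im, Complex.ofReal_im, zero_sub, neg_neg]
  exact div_nonneg hz'.le (Complex.normSq_nonneg _)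

/-! ### The polynomial equation for `u`. -/

open Polynomial in
/-- The polynomial satisfied by `u = 1 + σ² c m(z)`. -/
noncomputable def canonicalPoly {ι : Type*} [Fintype ι] [DecidableEq ι] (l : ι → ℝ)
    (k s : ℝ) (z : ℂ) : ℂ[X] :=
  (X - 1) * ∏ i, (C (l i : ℂ) - (C z * X ^ 2 - C (s : ℂ) * X))
    - C ((k / Fintype.card ι : ℝ) : ℂ) * X *
      ∑ i, ∏ j ∈ Finset.univ.erase i, (C (l j : ℂ) - (C z * X ^ 2 - C (s : ℂ) * X))

-- Each factor has the same degree `d`: 2 if `z ≠ 0`, 1 if `z = 0` and `s ≠ 0`. The first product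
-- has degree `1 + M d`, above the bound `1 + (M - 1) d` for the sum. For `z = s = 0` the factors
-- are constant and this comparison fails, hence the exclusion of `x = 0` when `c = 1`.
open Polynomial in
theorem canonicalPoly_ne_zero {ι : Type*} [Fintype ι] [DecidableEq ι] [Nonempty ι] (l : ι → ℝ)
    (k s : ℝ) (z : ℂ) (h : z ≠ 0 ∨ s ≠ 0) : canonicalPoly l k s z ≠ 0 := by
  set P : ι → ℂ[X] := fun i => C (l i : ℂ) - (C z * X ^ 2 - C (s : ℂ) * X) with hP
  obtain ⟨d, hd, hPd⟩ : ∃ d : ℕ, 0 < d ∧ ∀ i, (P i).degree = d := by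
    by_cases hz : z = 0
    · have hs : (s : ℂ) ≠ 0 := by
        rcases h with h | h
        · exact absurd hz h
        · exact_mod_cast h
      refine ⟨1, one_pos, fun i => ?_⟩
      have : P i = C (s : ℂ) * X + C (l i : ℂ) := by simp [hP, hz]; ring
      rw [this, degree_linear hs]; rfl
    · refine ⟨2, two_pos, fun i => ?_⟩
      have : P i = C (-z) * X ^ 2 + C (s : ℂ) * X + C (l i : ℂ) := by simp [hP]; ring
      rw [this, degree_quadratic (neg_ne_zero.2 hz)]; rfl
  have hprod : ∀ t : Finset ι, (∏ i ∈ t, P i).degree = ((t.card * d : ℕ) : WithBot ℕ) := by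
    intro t
    rw [degree_prod, Finset.sum_congr rfl fun i _ => hPd i]
    simp
  have h1 : ((X - 1 : ℂ[X]) * ∏ i, P i).degree = ((1 + Fintype.card ι * d : ℕ) : WithBot ℕ) := by
    rw [degree_mul, hprod, ← C_1, degree_X_sub_C, Finset.card_univ]; push_cast; rfl
  have h2 : (C ((k / Fintype.card ι : ℝ) : ℂ) * X *
      ∑ i, ∏ j ∈ Finset.univ.erase i, P j).degree ≤
      ((1 + (Fintype.card ι - 1) * d : ℕ) : WithBot ℕ) := by
    rw [Nat.cast_add]
    refine degree_mul_le_of_le (degree_C_mul_X_le _) ((degree_sum_le _ _).trans (Finset.sup_le fun i _ => ?_))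
    rw [hprod, Finset.card_erase_of_mem (Finset.mem_univ i), Finset.card_univ]
  have hcard : 0 < Fintype.card ι := Fintype.card_pos
  have h3 : 1 + (Fintype.card ι - 1) * d < 1 + Fintype.card ι * d := by
    have : (Fintype.card ι - 1) * d < Fintype.card ι * d :=
      Nat.mul_lt_mul_of_pos_right (by omega) hd
    omega
  intro h0
  have h4 := sub_eq_zero.1 (show (X - 1 : ℂ[X]) * ∏ i, P i - _ = 0 from h0)
  rw [← h4, h1] at h2
  exact absurd (by exact_mod_cast h2) (not_le.2 h3)

theorem canonicalPoly_eval {ι : Type*} [Fintype ι] [DecidableEq ι] (l : ι → ℝ) (k s : ℝ)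
    (z u : ℂ) : (canonicalPoly l k s z).eval u =
      (u - 1) * ∏ i, ((l i : ℂ) - (z * u ^ 2 - s * u))
      - ((k / Fintype.card ι : ℝ) : ℂ) * u *
        ∑ i, ∏ j ∈ Finset.univ.erase i, ((l j : ℂ) - (z * u ^ 2 - s * u)) := by
  simp [canonicalPoly, Polynomial.eval_prod, Polynomial.eval_finsetSum]

/-- Each factor equals `u * D i`, so this is the canonical equation cleared of denominators. -/
theorem canonicalPoly_eval_eq_zero {ι : Type*} [Fintype ι] [DecidableEq ι] {l : ι → ℝ}
    {k s : ℝ} {z m u : ℂ} (hm : u = 1 + k * m) (hu0 : u ≠ 0)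
    (hD : ∀ i, resolventDenom s (l i) z u ≠ 0)
    (heq : m = (1 / (Fintype.card ι : ℂ)) * ∑ i, (resolventDenom s (l i) z u)⁻¹) :
    (canonicalPoly l k s z).eval u = 0 := by
  have hfac : ∀ i, (l i : ℂ) - (z * u ^ 2 - s * u) = u * resolventDenom s (l i) z u := by
    intro i
    rw [resolventDenom]
    field_simp
    ring
  have hu1 : u - 1 = ((k / Fintype.card ι : ℝ) : ℂ) * ∑ i, (resolventDenom s (l i) z u)⁻¹ := by
    rw [hm, add_sub_cancel_left, ← hm]
    nth_rw 1 [heq]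
    push_cast
    ring
  rw [canonicalPoly_eval, hu1]
  simp_rw [hfac]
  rw [sub_eq_zero, mul_assoc, mul_assoc, Finset.sum_mul, Finset.mul_sum _ _ u]
  congr 1
  refine Finset.sum_congr rfl fun i _ => ?_
  rw [← Finset.mul_prod_erase _ _ (Finset.mem_univ i)]
  have := hD i
  field_simp

/-! ### Bounds and boundary values for the scalar equation. -/

/-- `m` solves, at the point `z` of the upper half-plane, the scalar form of the canonical equation
with eigenvalues `l`, and has the expected signs of imaginary parts. -/
structure IsCanonicalSolution {ι : Type*} [Fintype ι] (l : ι → ℝ) (k s : ℝ) (z m : ℂ) : Prop where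
  im_nonneg : 0 ≤ (1 + k * m).im
  im_mul_pos : 0 < (z * (1 + k * m)).im
  eq_sum : m = (1 / (Fintype.card ι : ℂ)) *
    ∑ i, (resolventDenom s (l i) z (1 + k * m))⁻¹

section scalar

variable {ι : Type*} [Fintype ι] [Nonempty ι] {l : ι → ℝ} {k s : ℝ} {z m : ℂ}

theorem IsCanonicalSolution.half_le_re (h : IsCanonicalSolution l k s z m) (hl : ∀ i, 0 ≤ l i)
    (hk : 0 < k) (hs : 0 ≤ s) (hz : z ∈ upperHalf) : 1 / 2 ≤ (1 + k * m).re := by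
  obtain ⟨α, β, hα, hβ, -, hb⟩ := exists_balance hl hk rfl h.im_nonneg h.im_mul_pos h.eq_sum
  obtain ⟨h1, h2⟩ := one_sub_pos_and_mul_norm_le hα hs hz h.im_nonneg h.im_mul_pos hb
  exact _root_.half_le_re hα hβ hs h1 h2 hb

theorem IsCanonicalSolution.norm_sq_le (h : IsCanonicalSolution l k s z m) (hl : ∀ i, 0 ≤ l i)
    (hk : 0 < k) (hs : 0 ≤ s) (hz : z ∈ upperHalf) : k * ‖m‖ ^ 2 * ‖z‖ ≤ 1 := by
  obtain ⟨α, β, hα, hβ, hm, hb⟩ := exists_balance hl hk rfl h.im_nonneg h.im_mul_pos h.eq_sum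
  obtain ⟨h1, h2⟩ := one_sub_pos_and_mul_norm_le hα hs hz h.im_nonneg h.im_mul_pos hb
  have := mul_le_mul_of_nonneg_right hm (norm_nonneg z)
  linarith

/-- The real part of the balance reads `1 + s α = (1 - β) Re u + α Re (z u)`. Smallness of `z u`
absorbs half of `s α`, so `s α ≤ 2 k |m|`; compare with `k |m|² ≤ α`. -/
theorem IsCanonicalSolution.norm_le_of_small (h : IsCanonicalSolution l k s z m)
    (hl : ∀ i, 0 ≤ l i) (hk : 0 < k) (hs : 0 ≤ s) (hz : z ∈ upperHalf)
    (hsmall : ‖z * (1 + k * m)‖ ≤ s / 2) : s * ‖m‖ ≤ 2 := by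
  obtain ⟨α, β, hα, hβ, hm, hb⟩ := exists_balance hl hk rfl h.im_nonneg h.im_mul_pos h.eq_sum
  obtain ⟨h1, -⟩ := one_sub_pos_and_mul_norm_le hα hs hz h.im_nonneg h.im_mul_pos hb
  have hre : 1 + s * α = (1 - β) * (1 + k * m).re + α * (z * (1 + k * m)).re := by
    have := congrArg Complex.re hb
    simp at this ⊢
    linarith
  have hu : (1 + k * m).re ≤ 1 + k * ‖m‖ := by
    simp only [Complex.add_re, Complex.one_re, Complex.re_ofReal_mul]
    gcongr
    exact Complex.re_le_norm m
  have hu' : (1 - β) * (1 + k * m).re ≤ 1 + k * ‖m‖ := by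
    have : 0 ≤ (1 + k * m).re := by linarith [h.half_le_re hl hk hs hz]
    nlinarith
  have hzu : α * (z * (1 + k * m)).re ≤ α * (s / 2) :=
    mul_le_mul_of_nonneg_left ((Complex.re_le_norm _).trans hsmall) hα.le
  have h3 : s * α ≤ 2 * k * ‖m‖ := by linarith
  have h4 : s * (k * ‖m‖ ^ 2) ≤ 2 * k * ‖m‖ :=
    (mul_le_mul_of_nonneg_left hm hs).trans h3
  rcases (norm_nonneg m).eq_or_lt with h0 | h0
  · rw [← h0]; norm_num
  · have : (k * ‖m‖) * (s * ‖m‖) ≤ (k * ‖m‖) * 2 := by linarith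
    exact le_of_mul_le_mul_left this (by positivity)

theorem eventually_norm_le {m : ℂ → ℂ} (hl : ∀ i, 0 ≤ l i) (hk : 0 < k) (hs : 0 ≤ s)
    (h : ∀ z ∈ upperHalf, IsCanonicalSolution l k s z (m z)) (x : ℝ) (hx : x ≠ 0 ∨ 0 < s) :
    ∃ C : ℝ, ∀ᶠ z in 𝓝[upperHalf] (x : ℂ), ‖m z‖ ≤ C := by
  have hself : ∀ᶠ z in 𝓝[upperHalf] (x : ℂ), z ∈ upperHalf := self_mem_nhdsWithin
  have htend : Tendsto (fun z : ℂ => ‖z‖) (𝓝[upperHalf] (x : ℂ)) (𝓝 ‖(x : ℂ)‖) :=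
    (continuous_norm.tendsto _).mono_left nhdsWithin_le_nhds
  by_cases hx0 : x = 0
  · have hs' : 0 < s := hx.resolve_left fun h => h hx0
    refine ⟨2 / s, ?_⟩
    have hlim : Tendsto (fun z : ℂ => ‖z‖ + √(k * ‖z‖)) (𝓝[upperHalf] (x : ℂ)) (𝓝 0) := by
      have : Tendsto (fun r : ℝ => r + √(k * r)) (𝓝 0) (𝓝 0) := by
        have hc : Continuous fun r : ℝ => r + √(k * r) := by fun_prop
        simpa using hc.tendsto 0
      refine this.comp ?_
      simpa [hx0] using htend
    filter_upwards [hself, hlim.eventually_le_const (half_pos hs')] with z hz hz2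
    rw [le_div_iff₀ hs', mul_comm]
    refine (h z hz).norm_le_of_small hl hk hs hz (le_trans ?_ hz2)
    -- The bound `k |m|² |z| ≤ 1` already makes `z u` tend to `0` with `z`, which is the smallness
    -- required.
    have h1 : ‖z‖ * (k * ‖m z‖) ≤ √(k * ‖z‖) := by
      apply Real.le_sqrt_of_sq_le
      have := mul_le_mul_of_nonneg_left ((h z hz).norm_sq_le hl hk hs hz)
        (mul_nonneg hk.le (norm_nonneg z))
      nlinarith
    calc ‖z * (1 + k * m z)‖ = ‖z‖ * ‖1 + k * m z‖ := norm_mul _ _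
      _ ≤ ‖z‖ * (1 + k * ‖m z‖) := by
        gcongr
        refine (norm_add_le _ _).trans ?_
        rw [norm_one, norm_mul, Complex.norm_real, Real.norm_of_nonneg hk.le]
      _ ≤ _ := by linarith
  · have hxn : 0 < |x| := abs_pos.2 hx0
    have hxn' : |x| / 2 < ‖(x : ℂ)‖ := by
      rw [Complex.norm_real, Real.norm_eq_abs]
      linarith
    refine ⟨√(k * (|x| / 2))⁻¹, ?_⟩
    filter_upwards [hself, htend.eventually_const_le hxn'] with z hz hz2
    apply Real.le_sqrt_of_sq_le
    rw [← one_div, le_div_iff₀ (by positivity)]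
    calc ‖m z‖ ^ 2 * (k * (|x| / 2)) ≤ ‖m z‖ ^ 2 * (k * ‖z‖) := by gcongr
      _ = k * ‖m z‖ ^ 2 * ‖z‖ := by ring
      _ ≤ 1 := (h z hz).norm_sq_le hl hk hs hz

theorem exists_boundary_value {m : ℂ → ℂ} (hcont : ContinuousOn m upperHalf)
    (hl : ∀ i, 0 ≤ l i) (hk : 0 < k) (hs : 0 ≤ s)
    (h : ∀ z ∈ upperHalf, IsCanonicalSolution l k s z (m z)) (x : ℝ) (hx : x ≠ 0 ∨ 0 < s) :
    ∃ ℓ : ℂ, Tendsto m (𝓝[upperHalf] (x : ℂ)) (𝓝 ℓ) ∧ 1 / 2 ≤ (1 + k * ℓ).re := by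
  classical
  have hself : ∀ᶠ z in 𝓝[upperHalf] (x : ℂ), z ∈ upperHalf := self_mem_nhdsWithin
  have := nhdsWithin_upperHalf_neBot x
  obtain ⟨C, hC⟩ := eventually_norm_le hl hk hs h x hx
  have hP : canonicalPoly l k s (x : ℂ) ≠ 0 :=
    canonicalPoly_ne_zero l k s _ (hx.imp (fun h => by exact_mod_cast h) fun h => h.ne')
  have hk0 : (k : ℂ) ≠ 0 := by exact_mod_cast hk.ne'
  have hinj : Function.Injective fun ℓ : ℂ => 1 + k * ℓ := fun a b hab =>
    mul_left_cancel₀ hk0 (add_left_cancel hab)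
  have hF : {ℓ : ℂ | (canonicalPoly l k s (x : ℂ)).eval (1 + k * ℓ) = 0}.Finite :=
    (Polynomial.finite_setOfPred_isRoot hP).preimage hinj.injOn
  obtain ⟨ℓ, hℓ⟩ := exists_tendsto_of_finite_mapClusterPt convex_upperHalf hcont hC hF
    fun ℓ hℓ => by
    obtain ⟨V, hV, hVℓ⟩ := mapClusterPt_iff_ultrafilter.1 hℓ
    have hz : Tendsto (fun z : ℂ => z) V (𝓝 (x : ℂ)) := hV.trans nhdsWithin_le_nhds
    -- Joint continuity in `(z, m)` carries the polynomial equation to the limit, even where the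
    -- denominators could degenerate.
    have hG : Continuous fun p : ℂ × ℂ => (canonicalPoly l k s p.1).eval (1 + k * p.2) := by
      simp_rw [canonicalPoly_eval]
      fun_prop
    have hlim := (hG.tendsto ((x : ℂ), ℓ)).comp (hz.prodMk_nhds hVℓ)
    refine tendsto_nhds_unique_of_eventuallyEq hlim (tendsto_const_nhds (x := (0 : ℂ))) ?_
    filter_upwards [hV hself] with z hzU
    have hsol := h z hzU
    refine canonicalPoly_eval_eq_zero rfl (fun h0 => ?_)
      (fun i => resolventDenom_ne_zero (hl i) hsol.im_nonneg hsol.im_mul_pos) hsol.eq_sum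
    have := hsol.im_mul_pos
    rw [h0] at this
    simp at this
  refine ⟨ℓ, hℓ, ?_⟩
  have hre : Continuous fun w : ℂ => (1 + k * w).re := by fun_prop
  refine ge_of_tendsto ((hre.tendsto ℓ).comp hℓ) ?_
  filter_upwards [hself] with z hz
  exact (h z hz).half_le_re hl hk hs hz

end scalar

/-! ### From the matrix equation to the scalar one. -/

open ComplexOrder in
theorem eigenvalues_mul_conjTranspose_nonneg {M N : ℕ} (B : Matrix (Fin M) (Fin N) ℂ) (i : Fin M) :
    0 ≤ (Matrix.isHermitian_mul_conjTranspose_self B).eigenvalues i :=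
  (Matrix.posSemidef_self_mul_conjTranspose B).eigenvalues_nonneg i

theorem canonicalRHS_eq_sum {M N : ℕ} (B : Matrix (Fin M) (Fin N) ℂ) (σ : ℝ) {z m u : ℂ}
    (hu : u = 1 + (σ ^ 2 * dimRatio M N : ℝ) * m) (him : 0 ≤ u.im) (hzu : 0 < (z * u).im) :
    canonicalRHS B σ z m = (1 / (Fintype.card (Fin M) : ℂ)) *
      ∑ i, (resolventDenom (σ ^ 2 * (1 - dimRatio M N))
        ((Matrix.isHermitian_mul_conjTranspose_self B).eigenvalues i) z u)⁻¹ := by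
  have hnn := eigenvalues_mul_conjTranspose_nonneg B
  have hu' : 1 + (σ : ℂ) ^ 2 * (dimRatio M N : ℂ) * m = u := by rw [hu]; push_cast; rfl
  simp only [canonicalRHS, hu', Fintype.card_fin]
  rw [← add_smul, trace_inv_smul_add_smul (Matrix.isHermitian_mul_conjTranspose_self B)]
  · simp only [resolventDenom]
    push_cast
    rfl
  · intro i
    have := resolventDenom_ne_zero (s := σ ^ 2 * (1 - dimRatio M N)) (hnn i) him hzu
    simp only [resolventDenom] at this
    push_cast at this
    exact this

theorem IsDeterministicEquivalent.isCanonicalSolution {M N : ℕ} {B : Matrix (Fin M) (Fin N) ℂ}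
    {σ : ℝ} {μ : Measure ℝ} (hμ : IsDeterministicEquivalent B σ μ)
    (hk : 0 < σ ^ 2 * dimRatio M N) {z : ℂ} (hz : z ∈ upperHalf) :
    IsCanonicalSolution (Matrix.isHermitian_mul_conjTranspose_self B).eigenvalues
      (σ ^ 2 * dimRatio M N) (σ ^ 2 * (1 - dimRatio M N)) z (stieltjes μ z) := by
  have := hμ.isProbabilityMeasure
  have h1 : 0 ≤ (1 + (σ ^ 2 * dimRatio M N : ℝ) * stieltjes μ z).im := by
    rw [Complex.add_im, Complex.im_ofReal_mul, Complex.one_im, zero_add]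
    exact mul_nonneg hk.le (stieltjes_im_nonneg μ hz)
  have h2 : 0 < (z * (1 + (σ ^ 2 * dimRatio M N : ℝ) * stieltjes μ z)).im := by
    rw [mul_add, mul_one, mul_left_comm, Complex.add_im, Complex.im_ofReal_mul]
    exact add_pos hz (mul_pos hk (hμ.im_pos z hz))
  refine ⟨h1, h2, ?_⟩
  rw [← canonicalRHS_eq_sum B σ rfl h1 h2]
  refine hμ.equation z ?_
  rintro ⟨x, -, rfl⟩
  simp [upperHalf] at hz

theorem theorem2 {M N : ℕ} (hM : 0 < M) (hMN : M ≤ N)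
    (B : Matrix (Fin M) (Fin N) ℂ) (σ : ℝ) (hσ : 0 < σ)
    (μ : Measure ℝ) (hμ : IsDeterministicEquivalent B σ μ) :
    (dimRatio M N < 1 →
      (∀ z ∈ upperHalf,
        1 / 2 ≤ (1 + (σ : ℂ) ^ 2 * (dimRatio M N : ℂ) * stieltjes μ z).re) ∧
      (∀ x : ℝ, ∃ ℓ : ℂ, IsBoundaryValue μ x ℓ ∧
        1 / 2 ≤ (1 + (σ : ℂ) ^ 2 * (dimRatio M N : ℂ) * ℓ).re)) ∧
    (dimRatio M N = 1 →
      (∀ z ∈ upperHalf,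
        1 / 2 ≤ (1 + (σ : ℂ) ^ 2 * (dimRatio M N : ℂ) * stieltjes μ z).re) ∧
      (∀ x : ℝ, x ≠ 0 → ∃ ℓ : ℂ, IsBoundaryValue μ x ℓ ∧
        1 / 2 ≤ (1 + (σ : ℂ) ^ 2 * (dimRatio M N : ℂ) * ℓ).re)) := by
  have := hμ.isProbabilityMeasure
  have : Nonempty (Fin M) := ⟨⟨0, hM⟩⟩
  have hN : 0 < N := hM.trans_le hMN
  have hc : 0 < dimRatio M N := by unfold dimRatio; positivity
  have hk : 0 < σ ^ 2 * dimRatio M N := by positivity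
  have hcont := continuousOn_stieltjes μ
  have hnn := eigenvalues_mul_conjTranspose_nonneg B
  have hsol := fun z hz => hμ.isCanonicalSolution hk (z := z) hz
  have hcast : ∀ w : ℂ, 1 + (σ : ℂ) ^ 2 * (dimRatio M N : ℂ) * w =
      1 + (σ ^ 2 * dimRatio M N : ℝ) * w := fun w => by push_cast; rfl
  simp only [hcast]
  constructor
  · intro hlt
    have hs : 0 < σ ^ 2 * (1 - dimRatio M N) := mul_pos (by positivity) (by linarith)
    exact ⟨fun z hz => (hsol z hz).half_le_re hnn hk hs.le hz,
      fun x => exists_boundary_value hcont hnn hk hs.le hsol x (Or.inr hs)⟩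
  · intro heq
    have hs : 0 ≤ σ ^ 2 * (1 - dimRatio M N) := by rw [heq]; simp
    exact ⟨fun z hz => (hsol z hz).half_le_re hnn hk hs hz,
      fun x hx => exists_boundary_value hcont hnn hk hs hsol x (Or.inl hx)⟩
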